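/- The brushing game on a finite simple graph $G$ is played by two players, Min and Max. Initially every vertex is dirty and there are no brushes on the vertices. The players alternate turns, Min moving first; on each turn the player adds one brush to a dirty vertex of his or her choice. Whenever a dirty vertex has at least as many brushes as it has dirty neighbors, it fires: it sends one brush to each of its dirty neighbors and becomes clean. After each turn vertices fire until no dirty vertex is ready to fire (the order of the firings affects neither the resulting set of dirty vertices nor the brushes on them). The game ends when all vertices are clean. Min wants to minimize, and Max to maximize, the total number of turns, and the game brush number $b_g(G)$ is the number of turns when both players play optimally. Theorem. For the complete graph $K_n$ on $n$ vertices, $$b_g(K_n) = (1+o(1))\,\frac{n^2}{e} \qquad (n\to\infty).$$ -/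

import Mathlib

open Filter Asymptotics

/-- A position of the brushing process: the set of vertices that are still dirty, and the number of
brushes currently lying on each vertex (brushes on clean vertices play no further role). -/
structure BrushState (V : Type*) where
  dirty : Finset V
  brushes : V → ℕ

namespace BrushState

variable {V : Type*} [DecidableEq V] (G : SimpleGraph V) [DecidableRel G.Adj]

/-- The dirty neighbours of `v`. -/
def dirtyNbrs (s : BrushState V) (v : V) : Finset V :=
  s.dirty.filter (fun u => G.Adj v u)

/-- A dirty vertex is ready to fire if it has at least as many brushes as dirty neighbours. -/
def Ready (s : BrushState V) (v : V) : Prop :=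
  v ∈ s.dirty ∧ (s.dirtyNbrs G v).card ≤ s.brushes v

/-- Firing `v`: it becomes clean and sends one brush to each of its dirty neighbours. -/
def fire (s : BrushState V) (v : V) : BrushState V where
  dirty := s.dirty.erase v
  brushes := fun u =>
    if u = v then s.brushes v - (s.dirtyNbrs G v).card
    else if u ∈ s.dirtyNbrs G v then s.brushes u + 1
    else s.brushes u

/-- Fire ready vertices, one at a time, until no vertex is ready. The choice of the next vertex is
arbitrary; by `firingSequence_eq_stabilize` it affects neither the resulting dirty set nor the
brushes on the dirty vertices. -/
noncomputable def stabilize (s : BrushState V) : BrushState V :=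
  open Classical in
  if h : ∃ v, s.Ready G v then (s.fire G h.choose).stabilize else s
termination_by s.dirty.card
decreasing_by exact Finset.card_erase_lt_of_mem h.choose_spec.1

/-- Put one more brush on `v`. -/
def place (s : BrushState V) (v : V) : BrushState V where
  dirty := s.dirty
  brushes := Function.update s.brushes v (s.brushes v + 1)

/-- One turn: the player puts a brush on `v`, and then vertices fire until the position is stable. -/
noncomputable def turn (s : BrushState V) (v : V) : BrushState V :=
  (s.place v).stabilize G

/-- `t` is obtained from `s` by firing one ready vertex. -/
def FiresTo (s t : BrushState V) : Prop :=
  ∃ v, s.Ready G v ∧ t = s.fire G v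

theorem fire_dirtyNbrs_card {s : BrushState V} {v u : V} (hv : v ∈ s.dirty)
    (hu : u ∈ (s.fire G v).dirty) :
    (s.fire G v).brushes u + ((s.fire G v).dirtyNbrs G u).card
      = s.brushes u + (s.dirtyNbrs G u).card := by
  have huv : u ≠ v := (Finset.mem_erase.1 hu).1
  have hus : u ∈ s.dirty := (Finset.mem_erase.1 hu).2
  have hd : (s.fire G v).dirtyNbrs G u = (s.dirtyNbrs G u).erase v := by
    simp [dirtyNbrs, fire, Finset.filter_erase]
  rw [hd]
  by_cases hadj : G.Adj v u
  · have h1 : v ∈ s.dirtyNbrs G u := by simp [dirtyNbrs, hv, hadj.symm]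
    have h2 : u ∈ s.dirtyNbrs G v := by simp [dirtyNbrs, hus, hadj]
    have h3 := Finset.card_erase_add_one h1
    simp only [fire, if_neg huv, if_pos h2]
    omega
  · have h1 : v ∉ s.dirtyNbrs G u := by simp [dirtyNbrs, G.adj_comm, hadj]
    have h2 : u ∉ s.dirtyNbrs G v := by simp [dirtyNbrs, hadj]
    rw [Finset.erase_eq_of_notMem h1]
    simp only [fire, if_neg huv, if_neg h2]

theorem firingSequence_invariant {s t : BrushState V}
    (h : Relation.ReflTransGen (FiresTo G) s t) :
    t.dirty ⊆ s.dirty ∧ ∀ u ∈ t.dirty,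
      t.brushes u + (t.dirtyNbrs G u).card = s.brushes u + (s.dirtyNbrs G u).card := by
  induction h with
  | refl => exact ⟨subset_rfl, fun _ _ => rfl⟩
  | tail _ hbc ih =>
    obtain ⟨v, hv, rfl⟩ := hbc
    refine ⟨(Finset.erase_subset _ _).trans ih.1, fun u hu => ?_⟩
    rw [fire_dirtyNbrs_card G hv.1 hu, ih.2 u (Finset.mem_of_mem_erase hu)]

theorem firingSequence_subset {s t t' : BrushState V}
    (h : Relation.ReflTransGen (FiresTo G) s t) (h' : Relation.ReflTransGen (FiresTo G) s t')
    (hstable : ∀ v, ¬ t'.Ready G v) : t'.dirty ⊆ t.dirty := by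
  induction h with
  | refl => exact (firingSequence_invariant G h').1
  | @tail b c hb hbc ih =>
    obtain ⟨v, hv, rfl⟩ := hbc
    refine Finset.subset_erase.2 ⟨ih, fun hv' => hstable v ⟨hv', ?_⟩⟩
    have h1 := (firingSequence_invariant G h').2 v hv'
    have h2 := (firingSequence_invariant G hb).2 v hv.1
    have h3 : (t'.dirtyNbrs G v).card ≤ (b.dirtyNbrs G v).card :=
      Finset.card_le_card (Finset.filter_subset_filter _ ih)
    have h4 := hv.2
    omega

theorem stabilize_spec (s : BrushState V) :
    Relation.ReflTransGen (FiresTo G) s (s.stabilize G) ∧ ∀ v, ¬ (s.stabilize G).Ready G v := by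
  induction hn : s.dirty.card using Nat.strong_induction_on generalizing s with
  | _ n ih =>
    rw [stabilize]
    split_ifs with h
    · have hlt : (s.fire G h.choose).dirty.card < n :=
        hn ▸ Finset.card_erase_lt_of_mem h.choose_spec.1
      obtain ⟨h1, h2⟩ := ih _ hlt _ rfl
      exact ⟨.head ⟨_, h.choose_spec, rfl⟩ h1, h2⟩
    · exact ⟨.refl, fun v hv => h ⟨v, hv⟩⟩

/-- The order in which vertices fire is irrelevant: every maximal sequence of firings ends with the
same dirty vertices, carrying the same numbers of brushes, as `stabilize`. -/
theorem firingSequence_eq_stabilize {s t : BrushState V}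
    (h : Relation.ReflTransGen (FiresTo G) s t) (hstable : ∀ v, ¬ t.Ready G v) :
    t.dirty = (s.stabilize G).dirty ∧ ∀ v ∈ t.dirty, t.brushes v = (s.stabilize G).brushes v := by
  obtain ⟨h1, h2⟩ := stabilize_spec G s
  have hd : t.dirty = (s.stabilize G).dirty :=
    (firingSequence_subset G h1 h hstable).antisymm (firingSequence_subset G h h1 h2)
  refine ⟨hd, fun v hv => ?_⟩
  have h3 := (firingSequence_invariant G h).2 v hv
  have h4 := (firingSequence_invariant G h1).2 v (hd ▸ hv)
  have h5 : (t.dirtyNbrs G v).card = ((s.stabilize G).dirtyNbrs G v).card := by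
    simp only [dirtyNbrs, hd]
  omega

/-- The total number of brushes that the dirty vertices still lack. -/
def deficit (s : BrushState V) : ℕ :=
  ∑ v ∈ s.dirty, ((s.dirtyNbrs G v).card - s.brushes v)

theorem deficit_le_of_firingSequence {s t : BrushState V}
    (h : Relation.ReflTransGen (FiresTo G) s t) : t.deficit G ≤ s.deficit G := by
  obtain ⟨h1, h2⟩ := firingSequence_invariant G h
  refine (Finset.sum_le_sum fun v hv => ?_).trans (Finset.sum_le_sum_of_subset h1)
  have h3 := h2 v hv
  have h4 : (t.dirtyNbrs G v).card ≤ (s.dirtyNbrs G v).card :=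
    Finset.card_le_card (Finset.filter_subset_filter _ h1)
  omega

theorem deficit_turn_lt {s : BrushState V} (hs : ∀ v, ¬ s.Ready G v) {v : V} (hv : v ∈ s.dirty) :
    (s.turn G v).deficit G < s.deficit G := by
  refine (deficit_le_of_firingSequence G (stabilize_spec G (s.place v)).1).trans_lt ?_
  refine Finset.sum_lt_sum (fun u _ => ?_) ⟨v, hv, ?_⟩
  · have h : s.brushes u ≤ (s.place v).brushes u := by
      by_cases huv : u = v
      · subst huv; simp [place]
      · simp [place, huv]
    exact Nat.sub_le_sub_left h _
  · have h : s.brushes v < (s.dirtyNbrs G v).card := not_le.1 fun h => hs v ⟨hv, h⟩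
    have h' : (s.place v).brushes v = s.brushes v + 1 := by simp [place]
    have h'' : (s.place v).dirtyNbrs G v = s.dirtyNbrs G v := rfl
    rw [h', h'']
    omega

end BrushState

/-- The two players. -/
inductive BrushPlayer
  | Min
  | Max

open BrushState in
/-- `MinForces G k p s`: in the position `s` with player `p` to move, Min can guarantee that the
game is over (all vertices are clean) after at most `k` further turns. The players alternate, and a
turn consists in adding a brush to a dirty vertex. -/
def MinForces {V : Type*} [DecidableEq V] (G : SimpleGraph V) [DecidableRel G.Adj] :
    ℕ → BrushPlayer → BrushState V → Prop
  | 0, _, s => s.dirty = ∅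
  | k + 1, .Min, s => s.dirty = ∅ ∨ ∃ v ∈ s.dirty, MinForces G k .Max (s.turn G v)
  | k + 1, .Max, s => s.dirty = ∅ ∨ ∀ v ∈ s.dirty, MinForces G k .Min (s.turn G v)

/-- The initial position: all vertices are dirty and there are no brushes; vertices without
neighbours are cleaned at once. -/
noncomputable def BrushState.initial {V : Type*} [Fintype V] [DecidableEq V] (G : SimpleGraph V)
    [DecidableRel G.Adj] : BrushState V :=
  BrushState.stabilize G ⟨Finset.univ, fun _ => 0⟩

/-- The game brush number: the length of the game under optimal play when Min starts, that is, the
least number of turns within which Min can force the end of the game. Such a number exists, by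
`exists_minForces_initial`. -/
noncomputable def gameBrushNumber {V : Type*} [Fintype V] [DecidableEq V] (G : SimpleGraph V)
    [DecidableRel G.Adj] : ℕ :=
  sInf {k : ℕ | MinForces G k .Min (BrushState.initial G)}

theorem minForces_of_deficit_le {V : Type*} [DecidableEq V] (G : SimpleGraph V)
    [DecidableRel G.Adj] (k : ℕ) (p : BrushPlayer) (s : BrushState V) (hs : ∀ v, ¬ s.Ready G v)
    (hk : s.deficit G ≤ k) : MinForces G k p s := by
  induction k generalizing p s with
  | zero =>
    by_contra hne
    obtain ⟨v, hv⟩ := Finset.nonempty_iff_ne_empty.2 hne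
    have := BrushState.deficit_turn_lt G hs hv
    omega
  | succ k ih =>
    have key : ∀ q, ∀ v ∈ s.dirty, MinForces G k q (s.turn G v) := fun q v hv =>
      ih q _ (BrushState.stabilize_spec G _).2 (by
        have := BrushState.deficit_turn_lt G hs hv
        omega)
    cases p with
    | Min =>
      rcases s.dirty.eq_empty_or_nonempty with h | ⟨v, hv⟩
      · exact Or.inl h
      · exact Or.inr ⟨v, hv, key _ v hv⟩
    | Max => exact Or.inr (key _)

/-- The game always ends, so that the set in `gameBrushNumber` is nonempty. -/
theorem exists_minForces_initial {V : Type*} [Fintype V] [DecidableEq V] (G : SimpleGraph V)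
    [DecidableRel G.Adj] : ∃ k, MinForces G k .Min (BrushState.initial G) :=
  ⟨_, minForces_of_deficit_le G _ _ _ (BrushState.stabilize_spec G _).2 le_rfl⟩

/-! On `K_n`, after `k` firings a dirty vertex holds the brushes placed on it by the players plus
`k`, and has `n - 1 - k` dirty neighbours. So it is ready exactly when the players have put at least
`n - 1 - 2k` brushes on it: the thresholds are `n - 1`, `n - 3`, …, and the first `j` of them sum to
`j (n - j)`.

Lower bound. Max always feeds an emptiest dirty vertex. For every sequence of `j` vertices this
keeps the useful brushes on it from exceeding the brushes outside it by more than `g j`, up to the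
pending move (`Balanced.update_argmin`). At the end, the first `j` fired vertices have reached all
their caps, so at least `2 j (n - j) - g j - 1` brushes were placed. The best `g` solves a linear
recursion; with `n - j = w n` the bound becomes `-2 w² log w · n²` to leading order, which is
maximal at `w = e^(-1/2)` with value `n² / e`.

Upper bound. Min always feeds a fullest dirty vertex. Let `m` vertices be dirty, with `R` placed
brushes. While Min completes a vertex that holds at least the average `R / m`, Max adds as many
brushes elsewhere. In the extremal case `dR/dm = 2R/m - 2m + n`, along which `finalBound`, that is
`m² exp (n/m + R/m² - 2)`, is conserved; it starts at `n² / e`. Each firing costs a bounded error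
(`finalBound_step`). Max could also let several vertices fire at once and waste brushes on them, but
the drop in `finalBound` pays for this waste (`finalBound_cascade`). Both errors are `O(n)`. -/

/-! ### Firing thresholds on the complete graph -/

namespace CompleteBrushing

open BrushState

variable {V : Type*}

/-- The vertices of `l` have, in this order, at least `t`, `t - 2`, `t - 4`, … brushes. -/
def Fired (c : V → ℕ) : ℤ → List V → Prop
  | _, [] => True
  | t, v :: l => t ≤ c v ∧ Fired c (t - 2) l

theorem fired_append {c : V → ℕ} (l l' : List V) (t : ℤ) :
    Fired c t (l ++ l') ↔ Fired c t l ∧ Fired c (t - 2 * l.length) l' := by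
  induction l generalizing t with
  | nil => simp [Fired]
  | cons v l ih =>
    simp only [List.cons_append, Fired, ih, List.length_cons, Nat.cast_add, Nat.cast_one]
    rw [show t - 2 - 2 * (l.length : ℤ) = t - 2 * (l.length + 1) by ring, and_assoc]

theorem Fired.congr {c c' : V → ℕ} {l : List V} {t : ℤ} (h : Fired c t l)
    (hc : ∀ v ∈ l, c' v = c v) : Fired c' t l := by
  induction l generalizing t with
  | nil => trivial
  | cons v l ih =>
    refine ⟨?_, ih h.2 fun w hw => hc w (List.mem_cons_of_mem _ hw)⟩
    rw [hc v (by simp)]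
    exact h.1

theorem Fired.lt_of_mem {c : V → ℕ} {l : List V} {t : ℤ} (h : Fired c t l) {v : V} (hv : v ∈ l) :
    t - 2 * l.length < c v := by
  induction l generalizing t with
  | nil => simp at hv
  | cons w l ih =>
    rcases List.mem_cons.1 hv with rfl | hv
    · have := h.1
      simp only [List.length_cons]
      push_cast
      omega
    · have := ih h.2 hv
      simp only [List.length_cons]
      push_cast
      omega

theorem Fired.sum_ge {c : V → ℕ} {l : List V} {t : ℤ} (h : Fired c t l) :
    (l.length : ℤ) * (t + 1 - l.length) ≤ ((l.map c).sum : ℕ) := by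
  induction l generalizing t with
  | nil => simp
  | cons w l ih =>
    have h1 := h.1
    have h2 := ih h.2
    simp only [List.length_cons, List.map_cons, List.sum_cons]
    push_cast at h2 ⊢
    nlinarith

theorem card_dirtyNbrs [DecidableEq V]
    [DecidableRel (SimpleGraph.completeGraph V).Adj] {s : BrushState V} {v : V} (hv : v ∈ s.dirty) :
    (s.dirtyNbrs (SimpleGraph.completeGraph V) v).card + 1 = s.dirty.card := by
  have : s.dirtyNbrs (SimpleGraph.completeGraph V) v = s.dirty.erase v := by
    ext u
    simp [dirtyNbrs, SimpleGraph.completeGraph, and_comm, eq_comm]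
  rw [this, Finset.card_erase_add_one hv]

variable [Fintype V] [DecidableEq V]

/-- In the position `s` on a complete graph, the vertices of `l` have fired in this order and the
players have put `c v` brushes on each vertex `v`. -/
structure Tracks (s : BrushState V) (c : V → ℕ) (l : List V) : Prop where
  nodup : l.Nodup
  mem_dirty : ∀ v, v ∈ s.dirty ↔ v ∉ l
  brushes : ∀ v ∈ s.dirty, s.brushes v = c v + l.length
  fired : Fired c ((Fintype.card V : ℤ) - 1) l

namespace Tracks

variable {s : BrushState V} {c : V → ℕ} {l : List V}

theorem dirty_eq (h : Tracks s c l) : s.dirty = l.toFinsetᶜ := by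
  ext v
  simp [h.mem_dirty]

theorem card_dirty (h : Tracks s c l) : s.dirty.card + l.length = Fintype.card V := by
  rw [h.dirty_eq, ← List.toFinset_card_of_nodup h.nodup, add_comm, Finset.card_add_card_compl]

theorem sum_dirty (h : Tracks s c l) : (l.map c).sum + ∑ v ∈ s.dirty, c v = ∑ v, c v := by
  rw [h.dirty_eq, ← List.sum_toFinset c h.nodup, Finset.sum_add_sum_compl]

theorem place (h : Tracks s c l) {v : V} (hv : v ∈ s.dirty) :
    Tracks (s.place v) (Function.update c v (c v + 1)) l where
  nodup := h.nodup
  mem_dirty := h.mem_dirty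
  brushes u hu := by
    have hu' := h.brushes u hu
    by_cases huv : u = v
    · subst huv
      simp [BrushState.place, hu']
      omega
    · simp [BrushState.place, huv, hu']
  fired := h.fired.congr fun u hu => by
    have : u ≠ v := by
      rintro rfl
      exact (h.mem_dirty u).1 hv hu
    simp [this]

variable [DecidableRel (SimpleGraph.completeGraph V).Adj]

theorem ready_iff (h : Tracks s c l) {v : V} (hv : v ∈ s.dirty) :
    s.Ready (SimpleGraph.completeGraph V) v ↔
      (Fintype.card V : ℤ) - 1 - 2 * l.length ≤ c v := by
  have h1 := card_dirtyNbrs hv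
  have h2 := h.card_dirty
  have h3 := h.brushes v hv
  simp only [Ready, hv, true_and]
  omega

theorem fire (h : Tracks s c l) {v : V} (hv : s.Ready (SimpleGraph.completeGraph V) v) :
    Tracks (s.fire (SimpleGraph.completeGraph V) v) c (l ++ [v]) where
  nodup := by
    have := (h.mem_dirty v).1 hv.1
    rw [List.nodup_append]
    refine ⟨h.nodup, by simp, ?_⟩
    rintro a ha b hb rfl
    simp at hb
    exact this (hb ▸ ha)
  mem_dirty u := by
    simp [BrushState.fire, h.mem_dirty, and_comm]
  brushes u hu := by
    have huv : u ≠ v := (Finset.mem_erase.1 hu).1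
    have hus : u ∈ s.dirty := (Finset.mem_erase.1 hu).2
    have h2 : u ∈ s.dirtyNbrs (SimpleGraph.completeGraph V) v := by
      simp [dirtyNbrs, hus, SimpleGraph.completeGraph, huv.symm]
    simp [BrushState.fire, huv, h2, h.brushes u hus]
    omega
  fired := by
    rw [fired_append]
    exact ⟨h.fired, (h.ready_iff hv.1).1 hv, trivial⟩

theorem firingSequence (h : Tracks s c l) {t : BrushState V}
    (hst : Relation.ReflTransGen (FiresTo (SimpleGraph.completeGraph V)) s t) :
    ∃ l', Tracks t c (l ++ l') := by
  induction hst with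
  | refl => exact ⟨[], by simpa using h⟩
  | tail _ hbc ih =>
    obtain ⟨v, hv, rfl⟩ := hbc
    obtain ⟨l', hl'⟩ := ih
    exact ⟨l' ++ [v], by simpa using hl'.fire hv⟩

theorem turn (h : Tracks s c l) {v : V} (hv : v ∈ s.dirty) :
    ∃ l', Tracks (s.turn (SimpleGraph.completeGraph V) v) (Function.update c v (c v + 1))
      (l ++ l') :=
  (h.place hv).firingSequence (stabilize_spec _ _).1

end Tracks

theorem tracks_initial [DecidableRel (SimpleGraph.completeGraph V).Adj] :
    ∃ l, Tracks (BrushState.initial (SimpleGraph.completeGraph V)) (fun _ => 0) l := by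
  have h : Tracks (⟨Finset.univ, fun _ => 0⟩ : BrushState V) (fun _ => 0) [] :=
    ⟨by simp, by simp, by simp, trivial⟩
  obtain ⟨l, hl⟩ := h.firingSequence (stabilize_spec (SimpleGraph.completeGraph V) _).1
  exact ⟨l, hl⟩

theorem sum_update_succ (c : V → ℕ) (v : V) :
    ∑ u, Function.update c v (c v + 1) u = (∑ u, c u) + 1 := by
  rw [Finset.sum_update_of_mem (Finset.mem_univ v), ← Finset.add_sum_erase _ c (Finset.mem_univ v),
    Finset.sdiff_singleton_eq_erase]
  ring

end CompleteBrushing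

/-! ### Max's strategy: feed an emptiest dirty vertex -/

namespace CompleteBrushing

open BrushState

variable {V : Type*}

/-- The brushes on the vertices of `l`, plus the same numbers capped at `t`, `t - 2`, `t - 4`, …. -/
def cappedValue (c : V → ℕ) : ℤ → List V → ℤ
  | _, [] => 0
  | t, v :: l => min (c v : ℤ) t + c v + cappedValue c (t - 2) l

theorem cappedValue_le (c : V → ℕ) (l : List V) (t : ℤ) :
    cappedValue c t l ≤ l.length * (t + 1 - l.length) + ((l.map c).sum : ℕ) := by
  induction l generalizing t with
  | nil => simp [cappedValue]
  | cons v l ih =>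
    have h := ih (t - 2)
    have h' := min_le_right (c v : ℤ) t
    simp only [cappedValue, List.length_cons, List.map_cons, List.sum_cons]
    push_cast at h ⊢
    nlinarith

theorem Fired.cappedValue_eq {c : V → ℕ} {l : List V} {t : ℤ} (h : Fired c t l) :
    cappedValue c t l = l.length * (t + 1 - l.length) + ((l.map c).sum : ℕ) := by
  induction l generalizing t with
  | nil => simp [cappedValue]
  | cons v l ih =>
    simp only [cappedValue, ih h.2, min_eq_right h.1, List.length_cons, List.map_cons,
      List.sum_cons]
    push_cast
    ring

theorem cappedValue_mono (c : V → ℕ) (l : List V) {t t' : ℤ} (h : t ≤ t') :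
    cappedValue c t l ≤ cappedValue c t' l := by
  induction l generalizing t t' with
  | nil => simp [cappedValue]
  | cons v l ih =>
    have h1 := ih (show t - 2 ≤ t' - 2 by omega)
    have h2 := min_le_min_left (c v : ℤ) h
    simp only [cappedValue]
    omega

theorem cappedValue_congr {c c' : V → ℕ} {l : List V} (t : ℤ) (h : ∀ v ∈ l, c' v = c v) :
    cappedValue c' t l = cappedValue c t l := by
  induction l generalizing t with
  | nil => rfl
  | cons v l ih =>
    simp only [cappedValue, ih _ fun w hw => h w (List.mem_cons_of_mem _ hw), h v (by simp)]

/-- Inserting `v` lowers the caps of the later vertices by 2, which cannot increase their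
contribution; `v` itself contributes at most `2 * c v`. -/
theorem cappedValue_append_cons_le (c : V → ℕ) (l l' : List V) (v : V) (t : ℤ) :
    cappedValue c t (l ++ v :: l') ≤ cappedValue c t (l ++ l') + 2 * c v := by
  induction l generalizing t with
  | nil =>
    have h1 := cappedValue_mono c l' (show t - 2 ≤ t by omega)
    have h2 := min_le_left (c v : ℤ) t
    simp only [List.nil_append, cappedValue]
    omega
  | cons w l ih =>
    have h1 := ih (t - 2)
    simp only [List.cons_append, cappedValue]
    omega

variable [DecidableEq V]

theorem cappedValue_update_le (c : V → ℕ) {l : List V} (hl : l.Nodup) (v : V) (t : ℤ) :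
    cappedValue (Function.update c v (c v + 1)) t l ≤ cappedValue c t l + 2 := by
  induction l generalizing t with
  | nil => simp [cappedValue]
  | cons w l ih =>
    rw [List.nodup_cons] at hl
    by_cases hw : w = v
    · subst hw
      have h1 : cappedValue (Function.update c w (c w + 1)) (t - 2) l = cappedValue c (t - 2) l :=
        cappedValue_congr _ fun u hu => by
          have : u ≠ w := fun h => hl.1 (h ▸ hu)
          simp [this]
      simp only [cappedValue, h1, Function.update_self]
      push_cast
      omega
    · have h1 := ih hl.2 (t - 2)
      simp only [cappedValue, Function.update_of_ne hw]
      omega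

variable [Fintype V]

theorem sum_ge_of_forall_le {c : V → ℕ} {l : List V} (hl : l.Nodup) {h : ℕ} (hc : ∀ u, h ≤ c u) :
    (Fintype.card V - l.length : ℤ) * h + ((l.map c).sum : ℕ) ≤ (∑ u, c u : ℕ) := by
  have h1 : (l.toFinsetᶜ).card * h ≤ ∑ u ∈ l.toFinsetᶜ, c u := by
    simpa using Finset.card_nsmul_le_sum (l.toFinsetᶜ) c h fun u _ => hc u
  have h2 := Finset.card_add_card_compl l.toFinset
  rw [List.toFinset_card_of_nodup hl] at h2
  rw [← Finset.sum_add_sum_compl l.toFinset c, List.sum_toFinset c hl, ← h2]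
  push_cast
  have h3 : ((l.toFinsetᶜ).card : ℤ) * h ≤ ∑ u ∈ l.toFinsetᶜ, (c u : ℤ) := by exact_mod_cast h1
  linarith

/-- Max's invariant: for every sequence `l` of vertices, the brushes on `l` that are useful for
firing `l` in this order exceed the brushes outside `l` by at most `g l.length + e`. -/
def Balanced (g : ℕ → ℝ) (e : ℝ) (c : V → ℕ) : Prop :=
  ∀ l : List V, l.Nodup → l.length < Fintype.card V →
    (cappedValue c ((Fintype.card V : ℤ) - 1) l : ℝ) ≤ (∑ u, c u : ℕ) + g l.length + e

/-- The growth condition on `g` under which Max can preserve `Balanced g 0`. -/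
def Admissible (n : ℕ) (g : ℕ → ℝ) : Prop :=
  (∀ j < n, 0 ≤ g j) ∧ ∀ j : ℕ, j + 1 < n →
    2 * (j + 1) * (n - (j + 1)) + 2 * (n - (j + 1)) - (n - (j + 1)) * (g (j + 1) - g j)
      ≤ 2 * g (j + 1)

theorem Balanced.update {g : ℕ → ℝ} {e : ℝ} {c : V → ℕ} (h : Balanced g e c) (v : V) :
    Balanced g (e + 1) (Function.update c v (c v + 1)) := by
  intro l hl hlen
  have h1 := h l hl hlen
  have h2 : (cappedValue (Function.update c v (c v + 1)) ((Fintype.card V : ℤ) - 1) l : ℝ)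
      ≤ cappedValue c ((Fintype.card V : ℤ) - 1) l + 2 := by
    exact_mod_cast cappedValue_update_le c hl v _
  rw [sum_update_succ]
  push_cast at h1 ⊢
  linarith

theorem Balanced.update_of_notMem {g : ℕ → ℝ} {c : V → ℕ} (h : Balanced g 1 c) {v : V}
    {l : List V} (hl : l.Nodup) (hlen : l.length < Fintype.card V) (hv : v ∉ l) :
    (cappedValue (Function.update c v (c v + 1)) ((Fintype.card V : ℤ) - 1) l : ℝ)
      ≤ (∑ u, Function.update c v (c v + 1) u : ℕ) + g l.length := by
  rw [cappedValue_congr (c := c) _ fun u hu => by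
    have : u ≠ v := fun h => hv (h ▸ hu)
    simp [this], sum_update_succ]
  have := h l hl hlen
  push_cast at this ⊢
  linarith

/-- Max's move adds to the total, which repairs the bound for every sequence avoiding `v`. A
sequence containing `v` is compared with the same sequence without `v`. -/
theorem Balanced.update_argmin {g : ℕ → ℝ} (hg : Admissible (Fintype.card V) g) {c : V → ℕ}
    (h : Balanced g 1 c) {v : V} (hv : ∀ u, c v ≤ c u) :
    Balanced g 0 (Function.update c v (c v + 1)) := by
  intro l hl hlen
  rw [add_zero]
  by_cases hvl : v ∈ l
  swap
  · exact h.update_of_notMem hl hlen hvl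
  obtain ⟨l₁, l₂, rfl⟩ := List.append_of_mem hvl
  have hlen' : (l₁ ++ v :: l₂).length = (l₁ ++ l₂).length + 1 := by simp; omega
  have hnd : (l₁ ++ l₂).Nodup := hl.sublist (by simp)
  have hv' : v ∉ l₁ ++ l₂ := by
    have := List.nodup_middle.1 hl
    exact (List.nodup_cons.1 this).1
  have key := h.update_of_notMem hnd (by omega) hv'
  have hadm := hg.2 (l₁ ++ l₂).length (by omega)
  set c' := Function.update c v (c v + 1) with hc'
  have hc'v : c' v = c v + 1 := by simp [hc']
  have hle : ∀ u, c v ≤ c' u := by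
    intro u
    by_cases huv : u = v
    · rw [huv, hc'v]; omega
    · simpa [hc', huv] using hv u
  -- If `g` grows by at least `2 * (c v + 1)`, this growth pays for inserting `v`. Otherwise `c v`
  -- is large, and as no vertex has fewer brushes, those outside the sequence hold enough;
  -- `Admissible` is what this case needs.
  rcases le_total (2 * ((c v : ℝ) + 1)) (g ((l₁ ++ l₂).length + 1) - g (l₁ ++ l₂).length)
    with hcase | hcase
  · have h1 : (cappedValue c' ((Fintype.card V : ℤ) - 1) (l₁ ++ v :: l₂) : ℝ)
        ≤ cappedValue c' ((Fintype.card V : ℤ) - 1) (l₁ ++ l₂) + 2 * c' v := by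
      exact_mod_cast cappedValue_append_cons_le c' l₁ l₂ v _
    rw [hlen']
    rw [hc'v] at h1
    push_cast at h1 key ⊢
    linarith
  · have h1 := cappedValue_le c' (l₁ ++ v :: l₂) ((Fintype.card V : ℤ) - 1)
    have h2 := sum_ge_of_forall_le hl hle
    have h3 : (cappedValue c' ((Fintype.card V : ℤ) - 1) (l₁ ++ v :: l₂) : ℝ) ≤
        ((l₁ ++ v :: l₂).length : ℝ) * (Fintype.card V - (l₁ ++ v :: l₂).length)
          + (∑ u, c' u : ℕ) - (Fintype.card V - (l₁ ++ v :: l₂).length : ℝ) * c v := by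
      have : cappedValue c' ((Fintype.card V : ℤ) - 1) (l₁ ++ v :: l₂) ≤
        ((l₁ ++ v :: l₂).length : ℤ) * (Fintype.card V - (l₁ ++ v :: l₂).length)
          + (∑ u, c' u : ℕ) - (Fintype.card V - (l₁ ++ v :: l₂).length : ℤ) * c v := by
        rw [show (Fintype.card V : ℤ) - 1 + 1 = Fintype.card V by ring] at h1
        linarith
      exact_mod_cast this
    rw [hlen'] at h3 hlen ⊢
    have hpos : (0 : ℝ) ≤ Fintype.card V - ((l₁ ++ l₂).length + 1) := by
      have : (((l₁ ++ l₂).length + 1 : ℕ) : ℝ) ≤ Fintype.card V := by exact_mod_cast hlen.le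
      push_cast at this
      linarith
    have h4 := mul_le_mul_of_nonneg_left hcase hpos
    push_cast at h3 h4 hadm hpos ⊢
    nlinarith

/-- The first `j` fired vertices meet their caps, which sum to `j (n - j)`, and hold at least that
many brushes; both terms of `cappedValue` are therefore at least `j (n - j)`. -/
theorem Tracks.sum_ge_of_dirty_eq_empty {g : ℕ → ℝ} {s : BrushState V} {c : V → ℕ} {l : List V}
    (h : Tracks s c l) (hs : s.dirty = ∅) (hb : Balanced g 1 c) {j : ℕ}
    (hj : j < Fintype.card V) :
    2 * (j * (Fintype.card V - j)) - g j - 1 ≤ ((∑ u, c u : ℕ) : ℝ) := by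
  have hlen := h.card_dirty
  rw [hs, Finset.card_empty, zero_add] at hlen
  have hjl : (l.take j).length = j := by rw [List.length_take]; omega
  have hf : Fired c ((Fintype.card V : ℤ) - 1) (l.take j) := by
    have := h.fired
    rw [← List.take_append_drop j l, fired_append] at this
    exact this.1
  have h1 := hb (l.take j) (h.nodup.sublist (List.take_sublist j l)) (by omega)
  have h2 := hf.sum_ge
  rw [hf.cappedValue_eq, hjl] at h1
  rw [hjl] at h2
  generalize ((l.take j).map c).sum = p at h1 h2
  have h2' : (j : ℝ) * (Fintype.card V - 1 + 1 - j) ≤ p := by exact_mod_cast h2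
  push_cast at h1 h2' ⊢
  nlinarith

variable [DecidableRel (SimpleGraph.completeGraph V).Adj]

/-- Fired vertices reached thresholds above the current one, which `v` misses; so a minimum over
dirty vertices is a minimum over all vertices, as `Balanced.update_argmin` requires. -/
theorem Tracks.le_of_argmin {s : BrushState V} {c : V → ℕ} {l : List V} (h : Tracks s c l)
    {v : V} (hv : v ∈ s.dirty) (hr : ¬ s.Ready (SimpleGraph.completeGraph V) v)
    (hmin : ∀ u ∈ s.dirty, c v ≤ c u) (u : V) : c v ≤ c u := by
  by_cases hu : u ∈ s.dirty
  · exact hmin u hu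
  · have h1 := h.fired.lt_of_mem (v := u) (by simpa [h.mem_dirty] using hu)
    rw [h.ready_iff hv] at hr
    omega

theorem le_of_minForces {g : ℕ → ℝ} (hg : Admissible (Fintype.card V) g) {j : ℕ}
    (hj : j < Fintype.card V) (k : ℕ) (s : BrushState V) (c : V → ℕ) (l : List V)
    (h : Tracks s c l) (hs : ∀ v, ¬ s.Ready (SimpleGraph.completeGraph V) v) :
    (Balanced g 0 c → MinForces (SimpleGraph.completeGraph V) k .Min s →
      2 * (j * (Fintype.card V - j)) - g j - 1 ≤ ((∑ u, c u : ℕ) : ℝ) + k) ∧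
    (Balanced g 1 c → MinForces (SimpleGraph.completeGraph V) k .Max s →
      2 * (j * (Fintype.card V - j)) - g j - 1 ≤ ((∑ u, c u : ℕ) : ℝ) + k) := by
  have hmono : Balanced g 0 c → Balanced g 1 c := fun hb l hl hlen =>
    (hb l hl hlen).trans (by linarith)
  have hend : Balanced g 1 c → s.dirty = ∅ →
      2 * (j * (Fintype.card V - j)) - g j - 1 ≤ ((∑ u, c u : ℕ) : ℝ) + k := fun hb he =>
    (h.sum_ge_of_dirty_eq_empty he hb hj).trans (by simp)
  induction k generalizing s c l with
  | zero => exact ⟨fun hb hf => hend (hmono hb) hf, fun hb hf => hend hb hf⟩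
  | succ k ih =>
    choose! l' hl' using fun v (hv : v ∈ s.dirty) => h.turn hv
    have step := fun v (hv : v ∈ s.dirty) => ih _ _ _ (hl' v hv) (stabilize_spec _ _).2
      (fun hb l hl hlen => (hb l hl hlen).trans (by linarith))
      (fun hb he => ((hl' v hv).sum_ge_of_dirty_eq_empty he hb hj).trans (by simp))
    simp only [sum_update_succ] at step
    refine ⟨fun hb hf => ?_, fun hb hf => ?_⟩
    · rcases hf with he | ⟨v, hv, hf⟩
      · exact hend (hmono hb) he
      · have := (step v hv).2 (by simpa using hb.update v) hf
        push_cast at this ⊢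
        linarith
    · rcases hf with he | hf
      · exact hend hb he
      · by_cases he : s.dirty = ∅
        · exact hend hb he
        obtain ⟨v, hv, hmin⟩ := Finset.exists_min_image s.dirty c
          (Finset.nonempty_iff_ne_empty.2 he)
        have := (step v hv).1
          (hb.update_argmin hg (h.le_of_argmin hv (hs v) hmin)) (hf v hv)
        push_cast at this ⊢
        linarith

theorem le_gameBrushNumber {g : ℕ → ℝ} (hg : Admissible (Fintype.card V) g)  {j : ℕ}
    (hj : j < Fintype.card V) :
    2 * (j * (Fintype.card V - j)) - g j - 1
      ≤ (gameBrushNumber (SimpleGraph.completeGraph V) : ℝ) := by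
  obtain ⟨l, hl⟩ := tracks_initial (V := V)
  have hf : MinForces (SimpleGraph.completeGraph V)
      (gameBrushNumber (SimpleGraph.completeGraph V)) .Min
      (BrushState.initial (SimpleGraph.completeGraph V)) :=
    Nat.sInf_mem (exists_minForces_initial (SimpleGraph.completeGraph V))
  have hb : Balanced g 0 (fun _ : V => 0) := by
    intro l _ hlen
    have h0 : ∀ t : ℤ, cappedValue (fun _ : V => 0) t l ≤ 0 := by
      clear * -
      induction l with
      | nil => simp [cappedValue]
      | cons v l ih =>
        intro t
        have := ih (t - 2)
        simp only [cappedValue]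
        omega
    have : (cappedValue (fun _ : V => 0) ((Fintype.card V : ℤ) - 1) l : ℝ) ≤ 0 := by
      exact_mod_cast h0 _
    simpa using this.trans (hg.1 _ hlen)
  simpa using (le_of_minForces hg hj _ _ _ _ hl (stabilize_spec _ _).2).1 hb hf

end CompleteBrushing

/-! ### Solving Max's recursion and optimizing the lower bound -/

namespace CompleteBrushing

/-- The bound in Max's invariant, as a function of the number `m` of vertices outside the sequence;
it is asymptotic to `n² (2 w - 2 w² + 2 w² log w)` for `m = w n`. -/
noncomputable def excessBound (n m : ℝ) : ℝ :=
  m * (m + 1) * (2 * (n + 2) * (1 / m - 1 / n) + 2 * Real.log (m / n))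

theorem excessBound_nonneg {n m : ℝ} (hm : 1 ≤ m) (hmn : m ≤ n) : 0 ≤ excessBound n m := by
  have hm0 : 0 < m := by linarith
  have hn0 : 0 < n := by linarith
  have h1 := Real.one_sub_inv_le_log_of_pos (div_pos hm0 hn0)
  have h2 : 1 / n ≤ 1 / m := one_div_le_one_div_of_le hm0 hmn
  have h3 : (m / n)⁻¹ = 1 + n * (1 / m - 1 / n) := by field_simp; ring
  unfold excessBound
  refine mul_nonneg (by positivity) ?_
  nlinarith

/-- Division by `m (m + 1) (m + 2)` turns the recursion into a bound on the increment of
`excessBound n m / (m (m + 1))`. The reciprocal term telescopes, and `log (1 + 1/m) ≤ 1/m` controls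
the logarithm. -/
theorem excessBound_step {n m : ℝ} (hm : 1 ≤ m) (hmn : m + 1 ≤ n) :
    2 * (n - m) * m + 2 * m - m * (excessBound n m - excessBound n (m + 1))
      ≤ 2 * excessBound n m := by
  have hm0 : 0 < m := by linarith
  have hn0 : 0 < n := by linarith
  have h1 : Real.log ((m + 1) / n) ≤ Real.log (m / n) + 1 / m := by
    have h := Real.log_le_sub_one_of_pos (show 0 < (m + 1) / m by positivity)
    rw [show (m + 1) / n = m / n * ((m + 1) / m) by field_simp,
      Real.log_mul (by positivity) (by positivity)]
    have h' : (m + 1) / m - 1 = 1 / m := by field_simp; ring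
    linarith
  have h2 : (1 : ℝ) / (m + 1) = 1 / m - 1 / (m * (m + 1)) := by field_simp; ring
  have h3 : m * (m + 1) * (m + 2) *
      (2 * (n + 2) * (1 / (m + 1) - 1 / n) + 2 * Real.log ((m + 1) / n)) ≤
      m * (m + 1) * (m + 2) *
      (2 * (n + 2) * (1 / m - 1 / n) + 2 * Real.log (m / n)
        - 2 * (n + 2) * (1 / (m * (m + 1))) + 2 * (1 / m)) := by
    refine mul_le_mul_of_nonneg_left ?_ (by positivity)
    rw [h2]
    nlinarith
  have h4 : m * (m + 1) * (m + 2) *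
      (2 * (n + 2) * (1 / m - 1 / n) + 2 * Real.log (m / n)
        - 2 * (n + 2) * (1 / (m * (m + 1))) + 2 * (1 / m)) =
      (m + 2) * excessBound n m - 2 * (m + 2) * (n + 1 - m) := by
    unfold excessBound
    field_simp
    ring
  have h5 : m * excessBound n (m + 1) = m * (m + 1) * (m + 2) *
      (2 * (n + 2) * (1 / (m + 1) - 1 / n) + 2 * Real.log ((m + 1) / n)) := by
    unfold excessBound
    ring
  nlinarith

theorem admissible_excessBound (n : ℕ) : Admissible n fun j => excessBound n (n - j) := by
  refine ⟨fun j hj => ?_, fun j hj => ?_⟩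
  · have : (j : ℝ) + 1 ≤ n := by exact_mod_cast hj
    exact excessBound_nonneg (by linarith) (by linarith [(Nat.cast_nonneg j : (0 : ℝ) ≤ j)])
  · have h : (j : ℝ) + 1 + 1 ≤ n := by exact_mod_cast hj
    have h0 : (0 : ℝ) ≤ j := Nat.cast_nonneg j
    have := excessBound_step (n := n) (m := n - (j + 1)) (by linarith) (by linarith)
    rw [show (n : ℝ) - (j + 1) + 1 = n - j by ring] at this
    push_cast
    linarith

theorem exp_neg_half_sq : Real.exp (-(1 / 2)) ^ 2 = 1 / Real.exp 1 := by
  rw [← Real.exp_nat_mul, one_div (Real.exp 1), ← Real.exp_neg]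
  norm_num

theorem gameBrushNumber_completeGraph_ge {n : ℕ} (hn : 2 ≤ n) :
    (n : ℝ) ^ 2 / Real.exp 1 - 13 * n
      ≤ gameBrushNumber (SimpleGraph.completeGraph (Fin n)) := by
  -- The maximizer of `-2 w² log w` is `w = e^(-1/2)`; rounding `w n` down to `m` costs only `O(n)`.
  set x : ℝ := n * Real.exp (-(1 / 2)) with hx
  have hn' : (2 : ℝ) ≤ n := by exact_mod_cast hn
  have hexp : (1 / 2 : ℝ) ≤ Real.exp (-(1 / 2)) := by
    have := Real.add_one_le_exp (-(1 / 2) : ℝ)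
    linarith
  have hexp1 : Real.exp (-(1 / 2)) < 1 := by
    rw [Real.exp_lt_one_iff]
    norm_num
  have hx1 : 1 ≤ x := by rw [hx]; nlinarith
  have hxn : x ≤ n := by rw [hx]; nlinarith
  set m : ℕ := ⌊x⌋₊ with hm
  have hmx : (m : ℝ) ≤ x := Nat.floor_le (by linarith)
  have hxm : x < m + 1 := Nat.lt_floor_add_one x
  have hm1 : 1 ≤ m := Nat.le_floor (by simpa using hx1)
  have hmn : m ≤ n := by exact_mod_cast hmx.trans hxn
  have hm1' : (1 : ℝ) ≤ m := by exact_mod_cast hm1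
  have hmn' : (m : ℝ) ≤ n := by exact_mod_cast hmn
  have key := le_gameBrushNumber (V := Fin n) (g := fun j => excessBound n (n - j))
    (by simpa using admissible_excessBound n) (j := n - m) (by simp; omega)
  simp only [Fintype.card_fin] at key
  rw [Nat.cast_sub hmn, sub_sub_cancel] at key
  have hlog : Real.log (m / n) ≤ -(1 / 2) := by
    rw [Real.log_le_iff_le_exp (by positivity), div_le_iff₀ (by positivity)]
    linarith
  have hval : excessBound n m ≤ 2 * m * (n - m) + 10 * n - m ^ 2 := by
    have h1 : excessBound n m = (m + 1) * (2 * (n + 2) * (1 - m / n)) +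
        m * (m + 1) * (2 * Real.log (m / n)) := by
      unfold excessBound
      field_simp
    have h2 : m * (m + 1) * (2 * Real.log (m / n)) ≤ (m : ℝ) * (m + 1) * (-1) :=
      mul_le_mul_of_nonneg_left (by linarith) (by positivity)
    have h3 : 2 * ((n : ℝ) + 2) * (1 - m / n) ≤ 2 * (n - m) + 4 := by
      have : (2 * ((n : ℝ) + 2) * (1 - m / n)) = 2 * (n - m) + 4 - 4 * (m / n) := by
        field_simp
        ring
      have : (0 : ℝ) ≤ m / n := by positivity
      linarith
    have h4 := mul_le_mul_of_nonneg_left h3 (show (0 : ℝ) ≤ m + 1 by positivity)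
    nlinarith
  have hsq : (n : ℝ) ^ 2 / Real.exp 1 = x ^ 2 := by
    rw [hx, mul_pow, exp_neg_half_sq]
    ring
  rw [hsq]
  nlinarith

end CompleteBrushing

/-! ### Analysis of Min's potential -/

namespace CompleteBrushing

/-- If `m` of the `n` vertices are dirty and carry `R` brushes put there by the players, then
`finalBound n m R` bounds the number of brushes not wasted on overfull vertices by the end of the
game, when Min plays well. -/
noncomputable def finalBound (n m R : ℝ) : ℝ :=
  m ^ 2 * Real.exp (n / m + R / m ^ 2 - 2)

theorem finalBound_mono (n m : ℝ) {R R' : ℝ} (h : R ≤ R') :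
    finalBound n m R ≤ finalBound n m R' := by
  unfold finalBound
  gcongr

/-- This is `1 + x ≤ exp x`. Equality holds at `R = m (2m - n)`, where both sides are `m²`. -/
theorem le_finalBound {n m R : ℝ} (hm : 0 < m) : n * m - m ^ 2 + R ≤ finalBound n m R := by
  have h := Real.add_one_le_exp (n / m + R / m ^ 2 - 2)
  have h' := mul_le_mul_of_nonneg_left h (sq_nonneg m)
  refine le_trans (le_of_eq ?_) h'
  field_simp
  ring

theorem exp_le_one_add_two_mul {x : ℝ} (h0 : 0 ≤ x) (h1 : x ≤ 1) : Real.exp x ≤ 1 + 2 * x := by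
  have := (abs_le.1 (Real.abs_exp_sub_one_sub_id_le (by rwa [abs_of_nonneg h0]))).2
  nlinarith

/-- The factor `(1 - 1/m)² ≤ exp (-2/m)` cancels the first-order growth of the exponent, leaving a
relative error `O(1/m²)`. By `hexp` the bound is at most `m²`, so the absolute error is constant. -/
theorem finalBound_step {n m R Y : ℝ} (hn : 0 ≤ n) (hm : 3 ≤ m) (hR : 0 ≤ R)
    (hexp : n / m + R / m ^ 2 ≤ 2) (hY : Y ≤ R * (1 - 2 / m) + 2 / m + (2 * m - n - 1)) :
    finalBound n (m - 1) Y ≤ finalBound n m R + 24 := by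
  have hm0 : 0 < m := by linarith
  have hm1 : 0 < m - 1 := by linarith
  have h1 : (m - 1) ^ 2 ≤ m ^ 2 * Real.exp (-(2 / m)) := by
    have h := Real.add_one_le_exp (-(1 / m))
    have h2 : (0 : ℝ) ≤ -(1 / m) + 1 := by
      have : 1 / m ≤ 1 := by rw [div_le_one hm0]; linarith
      linarith
    have h3 := pow_le_pow_left₀ h2 h 2
    rw [← Real.exp_nat_mul] at h3
    have h4 : ((2 : ℕ) : ℝ) * -(1 / m) = -(2 / m) := by push_cast; ring
    rw [h4] at h3
    have h5 := mul_le_mul_of_nonneg_left h3 (sq_nonneg m)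
    refine le_trans (le_of_eq ?_) h5
    field_simp
    ring
  have h2 : n / (m - 1) + Y / (m - 1) ^ 2 - 2 ≤
      (n / m + R / m ^ 2 - 2) + 2 / m + 3 / (m - 1) ^ 2 := by
    have h3 : Y / (m - 1) ^ 2 ≤
        (R * (1 - 2 / m) + 2 / m + (2 * m - n - 1)) / (m - 1) ^ 2 := by gcongr
    have h4 : (n / m + R / m ^ 2 - 2) + 2 / m + 3 / (m - 1) ^ 2 -
        (n / (m - 1) + (R * (1 - 2 / m) + 2 / m + (2 * m - n - 1)) / (m - 1) ^ 2 - 2) =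
        (n * m + R) / (m ^ 2 * (m - 1) ^ 2) := by
      field_simp
      ring
    have h5 : 0 ≤ (n * m + R) / (m ^ 2 * (m - 1) ^ 2) := by positivity
    linarith
  have h3 : finalBound n (m - 1) Y ≤ finalBound n m R * Real.exp (3 / (m - 1) ^ 2) := by
    unfold finalBound
    calc (m - 1) ^ 2 * Real.exp (n / (m - 1) + Y / (m - 1) ^ 2 - 2)
        ≤ (m ^ 2 * Real.exp (-(2 / m))) *
          Real.exp ((n / m + R / m ^ 2 - 2) + 2 / m + 3 / (m - 1) ^ 2) := by gcongr
      _ = _ := by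
        rw [mul_assoc, mul_assoc, ← Real.exp_add, ← Real.exp_add]
        congr 2
        ring
  have h4 : Real.exp (3 / (m - 1) ^ 2) ≤ 1 + 2 * (3 / (m - 1) ^ 2) := by
    refine exp_le_one_add_two_mul (by positivity) ?_
    rw [div_le_one (by positivity)]
    nlinarith
  have h5 : finalBound n m R ≤ m ^ 2 := by
    unfold finalBound
    have : Real.exp (n / m + R / m ^ 2 - 2) ≤ 1 := Real.exp_le_one_iff.2 (by linarith)
    nlinarith [sq_nonneg m]
  have h6 : 0 ≤ finalBound n m R := by unfold finalBound; positivity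
  have h7 : m ^ 2 * (2 * (3 / (m - 1) ^ 2)) ≤ 24 := by
    rw [mul_div_assoc', mul_div_assoc', div_le_iff₀ (by positivity)]
    nlinarith
  calc _ ≤ finalBound n m R * (1 + 2 * (3 / (m - 1) ^ 2)) :=
        h3.trans (mul_le_mul_of_nonneg_left h4 h6)
    _ = finalBound n m R + finalBound n m R * (2 * (3 / (m - 1) ^ 2)) := by ring
    _ ≤ finalBound n m R + m ^ 2 * (2 * (3 / (m - 1) ^ 2)) := by gcongr
    _ ≤ _ := by linarith

theorem le_log_of_one_sub_inv {u : ℝ} (hu : 1 ≤ u) :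
    (1 - u⁻¹) + (1 - u⁻¹) ^ 2 / 2 ≤ Real.log u := by
  have hu0 : 0 < u := by linarith
  have hpos : 0 < u⁻¹ := inv_pos.2 hu0
  have hle : u⁻¹ ≤ 1 := inv_le_one_of_one_le₀ hu
  have h := Real.hasSum_pow_div_log_of_abs_lt_one (x := 1 - u⁻¹)
    (by rw [abs_of_nonneg (by linarith)]; linarith)
  have h' := sum_le_hasSum (Finset.range 2)
    (fun i _ => by have : 0 ≤ 1 - u⁻¹ := by linarith
                   positivity) h
  rw [sub_sub_cancel, Real.log_inv, neg_neg] at h'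
  norm_num [Finset.sum_range_succ] at h'
  linarith

theorem exp_mul_sq_le {u e : ℝ} (hu1 : 1 < u) (hu : u ≤ 1.71) (he0 : 0 ≤ e) (he : e ≤ 2 - u) :
    Real.exp e * (u - 1) ^ 2 ≤ 3 * (1 - u⁻¹) ^ 2 + e * (1 - u⁻¹) * (1 + u⁻¹) := by
  have hu0 : 0 < u := by linarith
  have h1 : Real.exp e ≤ 1 + e * (3 - u) := by
    have := (abs_le.1 (Real.abs_exp_sub_one_sub_id_le
      (by rw [abs_of_nonneg he0]; linarith : |e| ≤ 1))).2
    nlinarith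
  have h2 : (1 + e * (3 - u)) * (u - 1) ^ 2 * u ^ 2 ≤ 3 * (u - 1) ^ 2 + e * (u - 1) * (u + 1) := by
    have h3 : u ^ 2 ≤ 3 := by nlinarith
    have h4 : (3 - u) * (u - 1) * u ^ 2 ≤ u + 1 := by
      -- This inequality dictates 1.71: it already fails at `u = 1.72`.
      have h5 : 0 ≤ (1.71 - u) * (u ^ 2 * (2.29 - u)) :=
        mul_nonneg (by linarith) (mul_nonneg (sq_nonneg u) (by linarith))
      have h6 : 0 ≤ (1.71 - u) * u := mul_nonneg (by linarith) hu0.le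
      norm_num at h5 h6 hu
      nlinarith
    have h5 := mul_le_mul_of_nonneg_left h3 (sq_nonneg (u - 1))
    have h6 := mul_le_mul_of_nonneg_left h4 (show 0 ≤ e * (u - 1) from mul_nonneg he0 (by linarith))
    linarith
  have h7 : 3 * (1 - u⁻¹) ^ 2 + e * (1 - u⁻¹) * (1 + u⁻¹) =
      (3 * (u - 1) ^ 2 + e * (u - 1) * (u + 1)) / u ^ 2 := by
    field_simp
  rw [h7, le_div_iff₀ (by positivity)]
  refine le_trans ?_ h2
  gcongr

/-- A cascade with a large ratio needs so many brushes on the dirty vertices that `finalBound` would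
exceed its permitted value. -/
theorem ratio_le_of_finalBound_le {n m₀ m₁ R : ℝ} (hn : 100000 ≤ n) (hm₁ : n / 2 ≤ m₁)
    (hm₀ : m₀ ≤ n) (hm : m₁ < m₀) (hR : (m₀ - m₁) * (m₀ + m₁ - n) ≤ R)
    (hF : finalBound n m₀ R ≤ n ^ 2 / Real.exp 1 + 24 * (n + 1)) : m₀ / m₁ ≤ 1.71 := by
  have hn0 : 0 < n := by linarith
  have hm₁0 : 0 < m₁ := by linarith
  have hm₀0 : 0 < m₀ := by linarith
  by_contra! hlt
  rw [lt_div_iff₀ hm₁0] at hlt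
  set p := n / m₀ with hp
  set s := 1 - m₁ / m₀ with hs
  set r := R / m₀ ^ 2 with hr
  have hp1 : 1 ≤ p := by rw [hp, le_div_iff₀ hm₀0]; linarith
  have hp2 : p ≤ 1 / 0.855 := by
    rw [hp, div_le_div_iff₀ hm₀0 (by norm_num)]
    norm_num at hlt ⊢
    linarith
  have hs1 : 71 / 171 ≤ s := by
    have : m₁ / m₀ ≤ 100 / 171 := by
      rw [div_le_div_iff₀ hm₀0 (by norm_num)]
      norm_num at hlt
      linarith
    rw [hs]
    linarith
  have hs2 : s ≤ 1 - p / 2 := by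
    have : p / 2 ≤ m₁ / m₀ := by
      rw [hp, div_div, mul_comm, ← div_div]
      gcongr
    rw [hs]
    linarith
  have hr1 : s * (2 - s - p) ≤ r := by
    have : s * (2 - s - p) = (m₀ - m₁) * (m₀ + m₁ - n) / m₀ ^ 2 := by
      rw [hs, hp]
      field_simp
      ring
    rw [this, hr]
    gcongr
  have hr2 : r ≤ p - 1 + 0.001 := by
    have h1 : Real.exp (p + r - 1) ≤ p ^ 2 * 1.001 := by
      have h2 : finalBound n m₀ R = m₀ ^ 2 * (Real.exp (p + r - 1) / Real.exp 1) := by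
        rw [← Real.exp_sub, finalBound]
        congr 2
        ring
      have h3 : 24 * (n + 1) * Real.exp 1 ≤ 0.001 * n ^ 2 := by
        have := Real.exp_one_lt_d9
        have h4 : 24 * (n + 1) * Real.exp 1 ≤ 24 * (n + 1) * 2.8 := by
          gcongr
          linarith
        nlinarith
      rw [h2, ← mul_div_assoc, div_le_iff₀ (Real.exp_pos 1), add_mul,
        div_mul_cancel₀ _ (Real.exp_ne_zero 1)] at hF
      have h5 : p ^ 2 * 1.001 = n ^ 2 * 1.001 / m₀ ^ 2 := by rw [hp]; ring
      rw [h5, le_div_iff₀ (by positivity)]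
      linarith
    have h2 : p ^ 2 * 1.001 ≤ Real.exp (2 * (p - 1) + 0.001) := by
      have h3 : p ≤ Real.exp (p - 1) := by linarith [Real.add_one_le_exp (p - 1)]
      have h4 : (1.001 : ℝ) ≤ Real.exp 0.001 := by linarith [Real.add_one_le_exp (0.001 : ℝ)]
      rw [Real.exp_add, show 2 * (p - 1) = ((2 : ℕ) : ℝ) * (p - 1) by norm_num, Real.exp_nat_mul]
      gcongr
    have := Real.exp_le_exp.1 (h1.trans h2)
    linarith
  -- As a function of `s`, `s (2 - s - p)` increases up to `1 - p/2`, so its least value is at `s =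
  -- 71/171`; there it exceeds `p - 1 + 0.001` for all `p ≤ 1/0.855`.
  have h3 : 0 ≤ (s - 71 / 171) * (2 - p - s - 71 / 171) :=
    mul_nonneg (by linarith) (by linarith)
  norm_num at hp2 hr2
  nlinarith

/-- `D` is the waste when the dirty count falls from `m₀` to `m₁`. The two values of `finalBound`
differ by a factor `exp Y`, and `exp Y ≥ 1 + Y` reduces the claim to `hmain`, a scalar inequality in
`u` and `e`. -/
theorem finalBound_cascade {n m₀ m₁ R D : ℝ} (hn : 100000 ≤ n) (hm₁ : n / 2 ≤ m₁)
    (hm₀ : m₀ ≤ n) (hm : m₁ < m₀) (hR0 : 0 ≤ R) (hR : R ≤ m₁ * (2 * m₁ - n)) (hD0 : 0 ≤ D)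
    (hD : D ≤ (m₀ - m₁) ^ 2)
    (hF : finalBound n m₀ (R + (m₀ - m₁) * (m₀ + m₁ - n) + D)
      ≤ n ^ 2 / Real.exp 1 + 24 * (n + 1)) :
    finalBound n m₁ R + D ≤ finalBound n m₀ (R + (m₀ - m₁) * (m₀ + m₁ - n) + D) := by
  have hn0 : 0 < n := by linarith
  have hm₁0 : 0 < m₁ := by linarith
  have hm₀0 : 0 < m₀ := by linarith
  have hu := ratio_le_of_finalBound_le hn hm₁ hm₀ hm (by linarith) hF
  set u := m₀ / m₁ with hu_def
  set e := 2 - n / m₁ - R / m₁ ^ 2 with he_def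
  set R₀ := R + (m₀ - m₁) * (m₀ + m₁ - n) + D with hR₀
  have hu1 : 1 < u := by rw [hu_def, lt_div_iff₀ hm₁0]; linarith
  have hu0 : 0 < u := by linarith
  have he0 : 0 ≤ e := by
    have : e = (m₁ * (2 * m₁ - n) - R) / m₁ ^ 2 := by
      rw [he_def]
      field_simp
    rw [this]
    exact div_nonneg (by linarith) (by positivity)
  have he : e ≤ 2 - u := by
    have h1 : u ≤ n / m₁ := by rw [hu_def]; gcongr
    have h2 : 0 ≤ R / m₁ ^ 2 := by positivity
    rw [he_def]
    linarith
  have hscal := exp_mul_sq_le hu1 hu he0 he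
  have hlog := le_log_of_one_sub_inv hu1.le
  have hm₀u : m₀ = m₁ * u := by rw [hu_def]; field_simp
  have hid : n / m₀ + R₀ / m₀ ^ 2 - 2 + e =
      (1 - u⁻¹) * (1 + u⁻¹) * (e - 1) + D / m₀ ^ 2 := by
    rw [hR₀, he_def, hm₀u]
    field_simp
    ring
  set Y := n / m₀ + R₀ / m₀ ^ 2 - 2 + e + 2 * Real.log u with hY
  have hF0 : finalBound n m₀ R₀ = m₁ ^ 2 * Real.exp (-e) * Real.exp Y := by
    have h1 : u ^ 2 = Real.exp (2 * Real.log u) := by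
      rw [show 2 * Real.log u = ((2 : ℕ) : ℝ) * Real.log u by norm_num, Real.exp_nat_mul,
        Real.exp_log hu0]
    rw [finalBound, mul_assoc, ← Real.exp_add, hY,
      show -e + (n / m₀ + R₀ / m₀ ^ 2 - 2 + e + 2 * Real.log u) =
        2 * Real.log u + (n / m₀ + R₀ / m₀ ^ 2 - 2) by ring, Real.exp_add _ (_ - 2), ← h1,
        ← mul_assoc, ← mul_pow, ← hm₀u]
  have hF1 : finalBound n m₁ R = m₁ ^ 2 * Real.exp (-e) := by
    rw [finalBound, he_def]
    congr 2
    ring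
  have hYge : 2 * (1 - u⁻¹) ^ 2 + e * (1 - u⁻¹) * (1 + u⁻¹) + D / m₀ ^ 2 ≤ Y := by
    rw [hY, hid]
    nlinarith
  have hmain : D ≤ m₁ ^ 2 * Real.exp (-e) * Y := by
    have hL : m₀ - m₁ = m₁ * (u - 1) := by rw [hm₀u]; ring
    have hL0 : 0 < m₀ - m₁ := by linarith
    set d := D / (m₀ - m₁) ^ 2 with hd
    have hd0 : 0 ≤ d := by positivity
    have hd1 : d ≤ 1 := by rw [hd, div_le_one (by positivity)]; exact hD
    have hDd : D = d * (m₁ ^ 2 * (u - 1) ^ 2) := by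
      rw [← mul_pow, ← hL, hd]
      field_simp
    have hDm : D / m₀ ^ 2 = d * (1 - u⁻¹) ^ 2 := by
      rw [hDd, hm₀u]
      field_simp
    have hs0 : 0 ≤ 1 - u⁻¹ := by
      have : u⁻¹ ≤ 1 := inv_le_one_of_one_le₀ hu1.le
      linarith
    have hw : 0 ≤ e * (1 - u⁻¹) * (1 + u⁻¹) := by positivity
    have h1 : d * (Real.exp e * (u - 1) ^ 2) ≤ Y := by
      refine le_trans ?_ hYge
      rw [hDm]
      have h2 := mul_le_mul_of_nonneg_left hscal hd0
      nlinarith [sq_nonneg (1 - u⁻¹)]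
    calc D = m₁ ^ 2 * Real.exp (-e) * (d * (Real.exp e * (u - 1) ^ 2)) := by
          rw [hDd, Real.exp_neg]
          field_simp
      _ ≤ _ := by gcongr
  rw [hF0, hF1]
  have h := Real.add_one_le_exp Y
  have h' := mul_le_mul_of_nonneg_left h (show 0 ≤ m₁ ^ 2 * Real.exp (-e) by positivity)
  linarith

end CompleteBrushing

/-! ### Min's strategy: feed a fullest dirty vertex -/

namespace CompleteBrushing

open BrushState

variable {V : Type*}

theorem map_update_of_notMem [DecidableEq V] (c : V → ℕ) {l : List V} {v : V} (hv : v ∉ l) (a : ℕ) :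
    l.map (Function.update c v a) = l.map c :=
  List.map_congr_left fun u hu => Function.update_of_ne (by rintro rfl; exact hv hu) _ _

variable [Fintype V] [DecidableEq V]

/-- Min's potential, evaluated as if exactly the vertices of `l` had fired: the brushes wasted on
them, plus the number of brushes used otherwise by the end of the game. -/
noncomputable def potential (θ : ℝ) (c : V → ℕ) (l : List V) : ℝ :=
  ((l.map c).sum : ℕ) - l.length * (Fintype.card V - l.length : ℝ) +
    finalBound (Fintype.card V) (Fintype.card V - l.length)
      ((∑ v, c v : ℕ) - ((l.map c).sum : ℕ) + θ)

/-- Min's invariant, with `l` the list of fired vertices: Min's potential is small, if the fullest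
dirty vertex `w` is considered to be next to fire and the missing brushes on it are charged. -/
def Controlled (θ : ℝ) (c : V → ℕ) (l : List V) : Prop :=
  ∀ w ∉ l, (∀ v ∉ l, c v ≤ c w) →
    ((l.map c).sum : ℕ) - l.length * (Fintype.card V - l.length : ℝ) +
      finalBound (Fintype.card V) (Fintype.card V - l.length - 1)
        ((∑ v, c v : ℕ) - ((l.map c).sum : ℕ) + (Fintype.card V - 1 - 2 * l.length)
          - 2 * c w + θ)
      ≤ (Fintype.card V : ℝ) ^ 2 / Real.exp 1 + 24 * (l.length + 1)

/-- The argument of `finalBound` is unchanged: the total gains 1, `-2 * c w` loses 2, and `θ`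
reserves 1 for Max's reply. -/
theorem Controlled.update_argmax {c : V → ℕ} {l : List V} (h : Controlled 0 c l) {w : V}
    (hw : w ∉ l) (hmax : ∀ v ∉ l, c v ≤ c w) :
    Controlled 1 (Function.update c w (c w + 1)) l := by
  intro w' hw' hmax'
  have h1 : Function.update c w (c w + 1) w' = c w + 1 := by
    have h2 := hmax' w hw
    rw [Function.update_self] at h2
    by_cases hww : w' = w
    · simp [hww]
    · rw [Function.update_of_ne hww] at h2
      have := hmax w' hw'
      omega
  rw [map_update_of_notMem c hw, sum_update_succ, h1]
  refine le_trans (le_of_eq ?_) (h w hw hmax)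
  congr 2
  push_cast
  ring

/-- Max's brush uses up the reserve `θ = 1`, and the maximum over dirty vertices cannot decrease. -/
theorem Controlled.update {c : V → ℕ} {l : List V} (h : Controlled 1 c l) {u : V} (hu : u ∉ l) :
    Controlled 0 (Function.update c u (c u + 1)) l := by
  intro w' hw' hmax'
  obtain ⟨w, hw, hmax⟩ := Finset.exists_max_image (l.toFinsetᶜ) c ⟨u, by simpa using hu⟩
  simp only [Finset.mem_compl, List.mem_toFinset] at hw hmax
  have h1 : c w ≤ Function.update c u (c u + 1) w' := by
    refine le_trans ?_ (hmax' w hw)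
    by_cases hwu : w = u
    · simp [hwu]
    · simp [hwu]
  have h1' : (c w : ℝ) ≤ Function.update c u (c u + 1) w' := by exact_mod_cast h1
  rw [map_update_of_notMem c hu, sum_update_succ]
  refine le_trans ?_ (h w hw hmax)
  refine add_le_add_right (finalBound_mono _ _ ?_) _
  push_cast
  linarith

variable {s : BrushState V} {c : V → ℕ} {l : List V}

theorem Tracks.sum_le_of_max (h : Tracks s c l) {w : V} (hmax : ∀ v ∉ l, c v ≤ c w) :
    ((∑ v, c v : ℕ) : ℝ) - ((l.map c).sum : ℕ) ≤ (Fintype.card V - l.length) * c w := by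
  have h1 := h.sum_dirty
  have h2 := h.card_dirty
  have h3 := Finset.sum_le_card_nsmul s.dirty c (c w)
    fun v hv => hmax v ((h.mem_dirty v).1 hv)
  rw [← h1, ← h2]
  have h3' : ((∑ v ∈ s.dirty, c v : ℕ) : ℝ) ≤ s.dirty.card * c w := by exact_mod_cast h3
  push_cast at h3' ⊢
  linarith

theorem Tracks.sum_ge (h : Tracks s c l) : (l.map c).sum ≤ ∑ v, c v := by
  have := h.sum_dirty
  omega

variable [DecidableRel (SimpleGraph.completeGraph V).Adj]

theorem Tracks.lt_of_stable (h : Tracks s c l)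
    (hs : ∀ v, ¬ s.Ready (SimpleGraph.completeGraph V) v) {v : V} (hv : v ∉ l) :
    (c v : ℤ) < (Fintype.card V : ℤ) - 1 - 2 * l.length := by
  have hd := (h.mem_dirty v).2 hv
  have := hs v
  rw [h.ready_iff hd] at this
  omega

/-- The fullest dirty vertex holds at least the average, which is the hypothesis `hY` of
`finalBound_step`; the extra 24 in `Controlled` pays for that step. -/
theorem Tracks.controlled_of_potential_le (h : Tracks s c l)
    (hs : ∀ v, ¬ s.Ready (SimpleGraph.completeGraph V) v) (hn : 100000 ≤ Fintype.card V)
    {θ : ℝ} (hθ0 : 0 ≤ θ) (hθ1 : θ ≤ 1)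
    (hpot : potential θ c l ≤ (Fintype.card V : ℝ) ^ 2 / Real.exp 1 + 24 * l.length) :
    Controlled θ c l := by
  intro w hw hmax
  have hlt := h.lt_of_stable hs hw
  have hle := h.sum_le_of_max hmax
  have hge : (((l.map c).sum : ℕ) : ℝ) ≤ (∑ v, c v : ℕ) := by exact_mod_cast h.sum_ge
  have hcw : (c w : ℝ) + 1 ≤ Fintype.card V - 1 - 2 * l.length := by exact_mod_cast hlt
  have hcw0 : (0 : ℝ) ≤ c w := Nat.cast_nonneg _
  have hn' : (100000 : ℝ) ≤ Fintype.card V := by exact_mod_cast hn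
  unfold potential at hpot
  generalize (((l.map c).sum : ℕ) : ℝ) = P at *
  generalize ((∑ v, c v : ℕ) : ℝ) = T at *
  generalize (c w : ℝ) = a at *
  generalize (l.length : ℝ) = k at *
  generalize (Fintype.card V : ℝ) = n at *
  have hm : 3 ≤ n - k := by linarith
  have hm0 : 0 < n - k := by linarith
  have hstep := finalBound_step (n := n) (m := n - k) (R := T - P + θ)
    (Y := T - P + (n - 1 - 2 * k) - 2 * a + θ) (by linarith) hm (by linarith) ?_ ?_
  · linarith
  · rw [div_add_div _ _ (by positivity) (by positivity), div_le_iff₀ (by positivity)]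
    have h1 : T - P + θ ≤ (n - k) * (2 * (n - k) - n) := by nlinarith
    have h2 := mul_le_mul_of_nonneg_left h1 hm0.le
    nlinarith
  · have h1 : (T - P) * (2 / (n - k)) ≤ 2 * a := by
      rw [mul_div_assoc', div_le_iff₀ hm0]
      linarith
    have h2 : θ * (2 / (n - k)) ≤ 2 / (n - k) := mul_le_of_le_one_left (by positivity) hθ1
    linarith

theorem Tracks.turn_controlled (h : Tracks s c l)
    (hs : ∀ v, ¬ s.Ready (SimpleGraph.completeGraph V) v) (hn : 100000 ≤ Fintype.card V)
    {θ : ℝ} (hθ0 : 0 ≤ θ) (hθ1 : θ ≤ 1) {u : V} (hu : u ∉ l) {l' : List V}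
    (h' : Tracks (s.turn (SimpleGraph.completeGraph V) u) (Function.update c u (c u + 1)) (l ++ l'))
    (hc : Controlled θ (Function.update c u (c u + 1)) l) :
    Controlled θ (Function.update c u (c u + 1)) (l ++ l') := by
  have hs' : ∀ v, ¬ (s.turn (SimpleGraph.completeGraph V) u).Ready
    (SimpleGraph.completeGraph V) v := (stabilize_spec _ _).2
  set c' := Function.update c u (c u + 1) with hc'
  rcases l' with _ | ⟨v, l'⟩
  · simpa using hc
  have hvl : v ∉ l := fun hv => (List.nodup_append.1 h'.nodup).2.2 v hv v (by simp) rfl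
  have hf := (fired_append l (v :: l') _).1 h'.fired
  -- Stability before the turn leaves `u` as the only vertex that can fire first, and it meets its
  -- threshold exactly.
  have hvu : v = u := by
    by_contra hne
    have h1 := hf.2.1
    rw [hc', Function.update_of_ne hne] at h1
    have := h.lt_of_stable hs hvl
    omega
  subst hvu
  have hcv : (c' v : ℤ) = (Fintype.card V : ℤ) - 1 - 2 * l.length := by
    have h1 := hf.2.1
    have h2 := h.lt_of_stable hs hu
    have h3 : c' v = c v + 1 := by simp [hc']
    omega
  have hlow : ∀ w ∉ l, w ≠ v → (c' w : ℤ) < c' v := by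
    intro w hw hne
    rw [hcv, hc', Function.update_of_ne hne]
    exact h.lt_of_stable hs hw
  have hctrl := hc v hu fun w hw => by
    by_cases hne : w = v
    · rw [hne]
    · exact_mod_cast (hlow w hw hne).le
  have hSge := hf.2.2.sum_ge
  have hSle : ((l'.map c').sum : ℤ) ≤ l'.length * (c' v - 1) := by
    have h1 : ∀ x ∈ l'.map c', x ≤ c' v - 1 := by
      intro x hx
      obtain ⟨w, hw, rfl⟩ := List.mem_map.1 hx
      have hwl : w ∉ l := fun hwl =>
        (List.nodup_append.1 h'.nodup).2.2 w hwl w (by simp [hw]) rfl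
      have hwv : w ≠ v := by
        rintro rfl
        exact (List.nodup_cons.1 (List.nodup_append.1 h'.nodup).2.1).1 hw
      have := hlow w hwl hwv
      omega
    have h2 := List.sum_le_card_nsmul _ _ h1
    simp only [List.length_map, smul_eq_mul] at h2
    have h3 : ((c' v - 1 : ℕ) : ℤ) = c' v - 1 := by
      have : c' v = c v + 1 := by simp [hc']
      omega
    rw [← h3]
    exact_mod_cast h2
  have hPge := hf.1.sum_ge
  have hlen : (l ++ v :: l').length = l.length + 1 + l'.length := by simp; omega
  have hsum : ((l ++ v :: l').map c').sum = (l.map c').sum + c' v + (l'.map c').sum := by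
    simp [add_assoc]
  intro w hw hmax
  refine h'.controlled_of_potential_le hs' hn hθ0 hθ1 ?_ w hw hmax
  have hlt := h'.lt_of_stable hs' hw
  have hle := h'.sum_le_of_max hmax
  have hge : ((((l ++ v :: l').map c').sum : ℕ) : ℝ) ≤ (∑ v, c' v : ℕ) := by
    exact_mod_cast h'.sum_ge
  have hcw : (c' w : ℝ) + 1 ≤ Fintype.card V - 1 - 2 * (l ++ v :: l').length := by
    exact_mod_cast hlt
  have hcw0 : (0 : ℝ) ≤ c' w := Nat.cast_nonneg _
  have hn' : (100000 : ℝ) ≤ Fintype.card V := by exact_mod_cast hn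
  have hcv' : (c' v : ℝ) = Fintype.card V - 1 - 2 * l.length := by exact_mod_cast hcv
  unfold potential
  rw [hlen] at hcw hle ⊢
  rw [hsum] at hle hge ⊢
  generalize (l'.map c').sum = S at *
  generalize (l.map c').sum = P at *
  generalize (∑ v, c' v) = T at *
  have hSge' : (l'.length : ℝ) * ((Fintype.card V - 1 - 2 * l.length - 2) + 1 - l'.length) ≤ S := by
    exact_mod_cast hSge
  have hSle' : (S : ℝ) ≤ l'.length * (c' v - 1) := by exact_mod_cast hSle
  have hPge' : (l.length : ℝ) * ((Fintype.card V - 1) + 1 - l.length) ≤ P := by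
    exact_mod_cast hPge
  push_cast at *
  have hL0 : (0 : ℝ) ≤ l'.length := Nat.cast_nonneg _
  have hk0 : (0 : ℝ) ≤ l.length := Nat.cast_nonneg _
  generalize (l'.length : ℝ) = L at *
  generalize (l.length : ℝ) = k at *
  generalize (Fintype.card V : ℝ) = n at *
  generalize (c' w : ℝ) = a at *
  rw [hcv'] at hctrl hle hge hSle' ⊢
  -- Some vertex `w` is still dirty, and all dirty vertices lie below the new threshold; this gives
  -- the hypothesis `hR` of the cascade.
  have hR : (T : ℝ) - (P + (n - 1 - 2 * k) + S) + θ ≤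
      (n - (k + 1 + L)) * (2 * (n - (k + 1 + L)) - n) := by nlinarith
  -- The charge for `v` is now zero, and `S - L * (n - 2 * k - 2 - L)` is the waste on the `L`
  -- vertices firing after it.
  have harg : (T : ℝ) - P + (n - 1 - 2 * k) - 2 * (n - 1 - 2 * k) + θ =
      (T - (P + (n - 1 - 2 * k) + S) + θ) +
        ((n - k - 1) - (n - (k + 1 + L))) * ((n - k - 1) + (n - (k + 1 + L)) - n) +
        (S - L * (n - 2 * k - 2 - L)) := by ring
  rw [harg] at hctrl
  rcases hL0.eq_or_lt with rfl | hLpos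
  · have hS0 : (S : ℝ) = 0 := by
      have : (0 : ℝ) ≤ S := Nat.cast_nonneg _
      linarith
    rw [hS0] at hctrl ⊢
    ring_nf at hctrl ⊢
    linarith
  · have hcas := finalBound_cascade (n := n) (m₀ := n - k - 1) (m₁ := n - (k + 1 + L))
      (R := T - (P + (n - 1 - 2 * k) + S) + θ) (D := S - L * (n - 2 * k - 2 - L)) hn'
      (by linarith) (by linarith) (by linarith) (by linarith) hR (by linarith) (by nlinarith)
      (by linarith)
    linarith

/-- By `le_finalBound` the controlled quantity is at least the number of brushes placed plus twice
the number missing on `w`. -/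
theorem Tracks.sum_le_of_controlled (h : Tracks s c l)
    (hs : ∀ v, ¬ s.Ready (SimpleGraph.completeGraph V) v) {θ : ℝ} (hθ0 : 0 ≤ θ)
    (hc : Controlled θ c l) (hne : s.dirty.Nonempty) :
    ((∑ v, c v : ℕ) : ℝ) ≤
      (Fintype.card V : ℝ) ^ 2 / Real.exp 1 + 24 * (Fintype.card V + 1) := by
  obtain ⟨w, hw, hmax⟩ := Finset.exists_max_image s.dirty c hne
  simp only [h.mem_dirty] at hw hmax
  have hctrl := hc w hw hmax
  have hlt := h.lt_of_stable hs hw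
  have hcw : (c w : ℝ) + 1 ≤ Fintype.card V - 1 - 2 * l.length := by exact_mod_cast hlt
  have hcw0 : (0 : ℝ) ≤ c w := Nat.cast_nonneg _
  have hk0 : (0 : ℝ) ≤ l.length := Nat.cast_nonneg _
  have hF := le_finalBound (n := Fintype.card V) (m := Fintype.card V - l.length - 1)
    (R := (∑ v, c v : ℕ) - ((l.map c).sum : ℕ) + (Fintype.card V - 1 - 2 * l.length)
          - 2 * c w + θ) (by linarith)
  nlinarith

theorem minForces_of_controlled (hn : 100000 ≤ Fintype.card V) (k : ℕ) (s : BrushState V)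
    (c : V → ℕ) (l : List V) (h : Tracks s c l)
    (hs : ∀ v, ¬ s.Ready (SimpleGraph.completeGraph V) v)
    (hk : (Fintype.card V : ℝ) ^ 2 / Real.exp 1 + 24 * (Fintype.card V + 1)
      < (∑ v, c v : ℕ) + k) :
    (Controlled 0 c l → MinForces (SimpleGraph.completeGraph V) k .Min s) ∧
    (Controlled 1 c l → MinForces (SimpleGraph.completeGraph V) k .Max s) := by
  induction k generalizing s c l with
  | zero =>
    have key : ∀ θ : ℝ, 0 ≤ θ → Controlled θ c l → s.dirty = ∅ := by
      intro θ hθ hc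
      by_contra hne
      have := h.sum_le_of_controlled hs hθ hc (Finset.nonempty_iff_ne_empty.2 hne)
      push_cast at hk this
      linarith
    exact ⟨key 0 le_rfl, key 1 zero_le_one⟩
  | succ k ih =>
    choose! l' hl' using fun v (hv : v ∈ s.dirty) => h.turn hv
    have step := fun v (hv : v ∈ s.dirty) => ih _ _ _ (hl' v hv) (stabilize_spec _ _).2 (by
      rw [sum_update_succ]
      push_cast at hk ⊢
      linarith)
    refine ⟨fun hc => ?_, fun hc => Or.inr fun u hu => ?_⟩
    · by_cases he : s.dirty = ∅
      · exact Or.inl he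
      obtain ⟨w, hw, hmax⟩ := Finset.exists_max_image s.dirty c
        (Finset.nonempty_iff_ne_empty.2 he)
      have hw' := (h.mem_dirty w).1 hw
      simp only [h.mem_dirty] at hmax
      exact Or.inr ⟨w, hw, (step w hw).2 (h.turn_controlled hs hn zero_le_one le_rfl hw' (hl' w hw)
        (hc.update_argmax hw' hmax))⟩
    · have hu' := (h.mem_dirty u).1 hu
      exact (step u hu).1 (h.turn_controlled hs hn le_rfl zero_le_one hu' (hl' u hu)
        (hc.update hu'))

theorem gameBrushNumber_le (hn : 100000 ≤ Fintype.card V) :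
    (gameBrushNumber (SimpleGraph.completeGraph V) : ℝ) ≤
      (Fintype.card V : ℝ) ^ 2 / Real.exp 1 + 24 * (Fintype.card V + 1) + 1 := by
  obtain ⟨l, hl⟩ := tracks_initial (V := V)
  have hs : ∀ v, ¬ (BrushState.initial (SimpleGraph.completeGraph V)).Ready
    (SimpleGraph.completeGraph V) v := (stabilize_spec _ _).2
  have hnil : l = [] := by
    rcases l with _ | ⟨v, l⟩
    · rfl
    · have := hl.fired.1
      push_cast at this
      omega
  subst hnil
  have hn' : (100000 : ℝ) ≤ Fintype.card V := by exact_mod_cast hn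
  have hc : Controlled 0 (fun _ : V => 0) [] := by
    -- At the start the potential is `n² exp (1 + 0 - 2) = n² / e`: this is the source of the
    -- constant.
    refine hl.controlled_of_potential_le hs hn le_rfl zero_le_one (le_of_eq ?_)
    have h1 : (Fintype.card V : ℝ) / Fintype.card V = 1 := div_self (by positivity)
    simp only [potential, finalBound, List.map_nil, List.sum_nil, List.length_nil,
      Finset.sum_const_zero, Nat.cast_zero, zero_mul, sub_zero, zero_add, add_zero, zero_div,
      mul_zero, h1]
    rw [div_eq_mul_inv, ← Real.exp_neg]
    norm_num
  set B := (Fintype.card V : ℝ) ^ 2 / Real.exp 1 + 24 * (Fintype.card V + 1) with hB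
  have hf := (minForces_of_controlled hn (⌊B⌋₊ + 1) _ _ _ hl hs (by
    have := Nat.lt_floor_add_one B
    simpa using this)).1 hc
  have h1 : gameBrushNumber (SimpleGraph.completeGraph V) ≤ ⌊B⌋₊ + 1 := Nat.sInf_le hf
  have h2 : (⌊B⌋₊ : ℝ) ≤ B := Nat.floor_le (by positivity)
  have h3 : (gameBrushNumber (SimpleGraph.completeGraph V) : ℝ) ≤ (⌊B⌋₊ : ℝ) + 1 := by
    exact_mod_cast h1
  linarith

end CompleteBrushing

/-! ### Conclusion: both bounds agree up to `O(n)` -/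

theorem mainTheorem2 :
    (fun n : ℕ => (gameBrushNumber (SimpleGraph.completeGraph (Fin n)) : ℝ))
      ~[atTop] (fun n : ℕ => (n : ℝ) ^ 2 / Real.exp 1) := by
  have hO : (fun n : ℕ => (gameBrushNumber (SimpleGraph.completeGraph (Fin n)) : ℝ)
      - (n : ℝ) ^ 2 / Real.exp 1) =O[atTop] fun n : ℕ => (n : ℝ) := by
    refine IsBigO.of_bound 30 ?_
    filter_upwards [eventually_ge_atTop 100000] with n hn
    have h1 := CompleteBrushing.gameBrushNumber_completeGraph_ge (n := n) (by omega)
    have h2 := CompleteBrushing.gameBrushNumber_le (V := Fin n) (by simpa using hn)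
    rw [Fintype.card_fin] at h2
    have hn' : (100000 : ℝ) ≤ n := by exact_mod_cast hn
    rw [Real.norm_eq_abs, Real.norm_eq_abs, abs_of_nonneg (by positivity : (0 : ℝ) ≤ n), abs_le]
    constructor <;> linarith
  have ho : (fun n : ℕ => (n : ℝ)) =o[atTop] fun n : ℕ => (n : ℝ) ^ 2 / Real.exp 1 := by
    have h : (fun n : ℕ => (n : ℝ)) =o[atTop] fun n : ℕ => (n : ℝ) ^ 2 := by
      simpa [Function.comp_def] using (isLittleO_pow_pow_atTop_of_lt (𝕜 := ℝ)
        (show 1 < 2 by norm_num)).comp_tendsto (tendsto_natCast_atTop_atTop (R := ℝ))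
    simpa [div_eq_inv_mul] using h.const_mul_right (inv_ne_zero (Real.exp_ne_zero 1))
  exact hO.trans_isLittleO ho
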